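/- In a forcing notion (a preordered set) the stronger condition is the greater one; $p,q$ are compatible if they have a common upper bound, and a filter is a nonempty upward directed set that is closed under passing to weaker (smaller) conditions. For a cardinal $\kappa$ and a forcing notion $\mathbb Q$, $\mathbf{MA}_\kappa(\mathbb Q)$ says: for all maximal antichains $\mathcal A_\alpha\subseteq\mathbb Q$ ($\alpha<\kappa$) and every $p\in\mathbb Q$ there is a filter $G\subseteq\mathbb Q$ with $p\in G$ and $G\cap\mathcal A_\alpha\neq\emptyset$ for all $\alpha<\kappa$. Let $\mathbb Q_\circledcirc$ be the forcing notion whose conditions are the pairs $\langle a,w\rangle$ with $a$ a finite subset of $2^{<\omega}$ and $w$ a finite subset of $2^\omega$, ordered by: $\langle a_0,w_0\rangle\le\langle a_1,w_1\rangle$ if and only if $a_0\subseteq a_1$, $w_0\subseteq w_1$ and $$(\forall\eta\in w_0)(\forall l\in\omega)\,(\eta\restriction l\in a_1\Rightarrow\eta\restriction l\in a_0).$$ A real $x\in\omega^\omega$ of a generic extension of $\mathbf V$ is unbounded over $\mathbf V$ if for every $g\in\omega^\omega\cap\mathbf V$ there are infinitely many $n$ with $g(n)<x(n)$. **Theorem.**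 Assume $\mathbf{MA}_\kappa(\mathbb Q_\circledcirc)$, and let $\mathbb P$ be a forcing notion with $|\mathbb P|\le\kappa$. 1. If $\Vdash_{\mathbb P} 2^\omega\cap\mathbf V\neq 2^\omega$ (every condition forces that there is a new real), then $\mathbb P$ adds an unbounded real: there is a $\mathbb P$-name $\dot x$ for an element of $\omega^\omega$ such that $\Vdash_{\mathbb P}$ "$\dot x$ is unbounded over $\mathbf V$". 2. If it is only assumed that the complete Boolean algebra $\mathrm{RO}(\mathbb P)$ of regular open subsets of $\mathbb P$ is not $(\omega,\omega)$-distributive, i.e. the law $\bigwedge_n\bigvee_m a_{n,m}=\bigvee_{f\in\omega^\omega}\bigwedge_n a_{n,f(n)}$ fails in it, then there are $p\in\mathbb P$ and a $\mathbb P$-name $\dot x$ for an element of $\omega^\omega$ such that $p\Vdash_{\mathbb P}$ "$\dot x$ is unbounded over $\mathbf V$". -/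

import Mathlib

open Cardinal

universe u

namespace ForcingUnbounded

/-! Convention: in a forcing notion (a preorder) the stronger condition is the greater one. -/

section Forcing

variable {P : Type u} [Preorder P]

/-- Two conditions are compatible if they have a common upper bound (a common stronger condition). -/
def Compatible (p q : P) : Prop := ∃ r, p ≤ r ∧ q ≤ r

/-- `A` is a maximal antichain of the forcing notion: its elements are pairwise incompatible, and
every condition is compatible with some element of `A`. -/
def IsMaximalAntichain (A : Set P) : Prop :=
  (∀ p ∈ A, ∀ q ∈ A, p ≠ q → ¬ Compatible p q) ∧ ∀ p : P, ∃ q ∈ A, Compatible p q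

/-- `MA_κ(Q)`: for every family of `κ` maximal antichains of `Q` and every `p ∈ Q` there is a filter
containing `p` and meeting all of them. As stronger conditions are greater, the filters of
the forcing notion `Q` (nonempty, directed towards stronger conditions, closed under weakening) are
the order ideals in the sense of `Order.IsIdeal`. -/
def MartinAxiom (κ : Cardinal.{u}) (Q : Type*) [Preorder Q] : Prop :=
  ∀ (ι : Type u), #ι = κ → ∀ A : ι → Set Q, (∀ i, IsMaximalAntichain (A i)) → ∀ p : Q,
    ∃ G : Set Q, Order.IsIdeal G ∧ p ∈ G ∧ ∀ i, (G ∩ A i).Nonempty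

/-- A `P`-name for a function from `ω` to a set `X` of the ground model, given as the set of triples
`(n, x, p)` with `p ∈ dec n x`; its interpretation by a generic filter `G` is
`{(n, x) | G ∩ dec n x ≠ ∅}`. The two axioms say that every condition forces this
to be a function with domain `ω`. -/
structure SeqName (P : Type u) [Preorder P] (X : Type) where
  dec : ℕ → X → Set P
  functional : ∀ n x y p q, p ∈ dec n x → q ∈ dec n y → Compatible p q → x = y
  total : ∀ n (p : P), ∃ x, ∃ s ∈ dec n x, Compatible p s

variable {X : Type}

/-- `p ⊩ τ(n) = x`: the set `dec n x` is predense above `p`. -/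
def SeqName.ForcesVal (τ : SeqName P X) (p : P) (n : ℕ) (x : X) : Prop :=
  ∀ q, p ≤ q → ∃ s ∈ τ.dec n x, Compatible q s

/-- `p ⊩ τ = f`, for a function `f` of the ground model. -/
def SeqName.ForcesEq (τ : SeqName P X) (p : P) (f : ℕ → X) : Prop :=
  ∀ n, τ.ForcesVal p n (f n)

/-- `p ⊩ τ ∉ V`: for no `f ∈ V` does any condition stronger than `p` force `τ = f`. -/
def SeqName.ForcesNew (τ : SeqName P X) (p : P) : Prop :=
  ∀ f : ℕ → X, ∀ q, p ≤ q → ¬ τ.ForcesEq q f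

/-- `p ⊩ 2^ω ∩ V ≠ 2^ω`, that is, `p` forces that there is a member of `2^ω` outside `V`
(the usual clause for forcing an existential statement). -/
def ForcesNewReal (p : P) : Prop :=
  ∀ q, p ≤ q → ∃ r, q ≤ r ∧ ∃ τ : SeqName P Bool, τ.ForcesNew r

/-- `p ⊩` "`τ` is an unbounded real over `V`": for every `g ∈ ω^ω` of the ground model, `p` forces
that `g n < τ(n)` for infinitely many `n`. -/
def SeqName.ForcesUnbounded (τ : SeqName P ℕ) (p : P) : Prop :=
  ∀ g : ℕ → ℕ, ∀ N : ℕ, ∀ q, p ≤ q →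
    ∃ r, q ≤ r ∧ ∃ n, N ≤ n ∧ ∃ m, g n < m ∧ τ.ForcesVal r n m

end Forcing

/-- `RO(P)`, the Boolean algebra of regular open subsets of `P`, in the topology whose open
sets are the sets closed under passing to stronger (greater) conditions, ordered by inclusion.
It is complete. -/
abbrev RO (P : Type*) [Preorder P] : Type _ := Heyting.Regular (LowerSet Pᵒᵈ)

/-- The `(ω, ω)`-distributive law `⋀ₙ ⋁ₘ a n m = ⋁_{f : ω → ω} ⋀ₙ a n (f n)`, for a complete
Boolean algebra `B`: here `s n = ⋁ₘ a n m` and `t = ⋀ₙ s n`. -/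
def OmegaOmegaDistributive (B : Type*) [PartialOrder B] : Prop :=
  ∀ (a : ℕ → ℕ → B) (s : ℕ → B) (t : B),
    (∀ n, IsLUB (Set.range (a n)) (s n)) → IsGLB (Set.range s) t →
      IsLUB {b | ∃ f : ℕ → ℕ, IsGLB (Set.range fun n => a n (f n)) b} t

/-- The restriction `η ↾ l ∈ 2^{<ω}` of `η ∈ 2^ω`; finite binary sequences are lists. -/
def restr (η : ℕ → Bool) (l : ℕ) : List Bool := (List.range l).map η

/-- Conditions of the forcing notion `Q_⊚`: pairs `⟨a, w⟩` with `a` a finite subset of `2^{<ω}` and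
`w` a finite subset of `2^ω`. -/
structure QCirc where
  a : Finset (List Bool)
  w : Finset (ℕ → Bool)

/-- The order of `Q_⊚`. -/
instance : PartialOrder QCirc where
  le p q := p.a ⊆ q.a ∧ p.w ⊆ q.w ∧ ∀ η ∈ p.w, ∀ l : ℕ, restr η l ∈ q.a → restr η l ∈ p.a
  le_refl _ := ⟨subset_rfl, subset_rfl, fun _ _ _ h => h⟩
  le_trans _ _ _ h k := ⟨h.1.trans k.1, h.2.1.trans k.2.1,
    fun η hη l hl => h.2.2 η hη l (k.2.2 η (h.2.1 hη) l hl)⟩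
  le_antisymm p q h k := by
    cases p
    cases q
    exact congrArg₂ QCirc.mk (h.1.antisymm k.1) (h.2.1.antisymm k.2.1)

end ForcingUnbounded

/-! Let `A` be the union of the first coordinates of a filter on `QCirc`. A real in some `w` of the
filter has only finitely many initial segments in `A`; by genericity a new real has infinitely many.
Let `x n` be the least `l > n` with `τ ↾ l ∈ A`, for `τ` a new real. Given `g` and `q`, take a
ground model branch `η` whose initial segments are all possible for `τ` above `q`, and which misses
`A` from level `L` on. Forcing `τ` to agree with `η` up to `g n + 1`, for some `n ≥ L`, pushes the
next hit past `g n`. One branch per condition suffices, so `max κ ℵ₀` dense sets are enough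
(`SeqName.exists_forcesUnbounded`). For part 2, the family refuting distributivity is coded by a
single name for a subset of `ω`; if no condition forced it to be new, the law would hold. -/

namespace ForcingUnbounded

/-! ### Dense sets, names and decided values -/

section Forcing

variable {P : Type u} [Preorder P] {X : Type}

theorem Compatible.symm {p q : P} : Compatible p q → Compatible q p :=
  fun ⟨r, h, k⟩ => ⟨r, k, h⟩

/-- A cofinal set contains a maximal antichain. -/
theorem exists_isMaximalAntichain_subset {Q : Type*} [Preorder Q] {D : Set Q} (hD : IsCofinal D) :
    ∃ A ⊆ D, IsMaximalAntichain A := by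
  obtain ⟨A, hA⟩ := zorn_subset
    {A : Set Q | A ⊆ D ∧ ∀ p ∈ A, ∀ q ∈ A, p ≠ q → ¬ ∃ r, p ≤ r ∧ q ≤ r} fun C hC hchain => by
      refine ⟨⋃₀ C, ⟨Set.sUnion_subset fun s hs => (hC hs).1, ?_⟩,
        fun s hs => Set.subset_sUnion_of_mem hs⟩
      rintro p ⟨s, hs, hp⟩ q ⟨t, ht, hq⟩
      rcases hchain.total hs ht with h | h
      · exact (hC ht).2 p (h hp) q hq
      · exact (hC hs).2 p hp q (h hq)
  refine ⟨A, hA.prop.1, hA.prop.2, fun p => ?_⟩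
  obtain ⟨d, hd, hpd⟩ := hD p
  by_contra! hcon
  have hinc : ∀ q ∈ A, ¬ Compatible d q := fun q hq ⟨r, h, k⟩ => hcon q hq ⟨r, hpd.trans h, k⟩
  have hdA : d ∈ A := hA.le_of_ge (y := insert d A)
    ⟨Set.insert_subset hd hA.prop.1, by
      rintro p (rfl | hp) q (rfl | hq) hne
      · exact absurd rfl hne
      · exact hinc q hq
      · exact fun h => hinc p hp (Compatible.symm h)
      · exact hA.prop.2 p hp q hq hne⟩ (Set.subset_insert d A) (Set.mem_insert d A)
  exact hinc d hdA ⟨d, le_rfl, le_rfl⟩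

/-- Martin's axiom for at most `max κ ℵ₀` cofinal sets. -/
theorem MartinAxiom.exists_isIdeal {κ : Cardinal.{u}} {Q : Type*} [Preorder Q]
    (h : MartinAxiom κ Q) (p : Q) {ι : Type u} (hι : #ι ≤ max κ ℵ₀) (D : ι → Set Q)
    (hD : ∀ i, IsCofinal (D i)) :
    ∃ G : Set Q, Order.IsIdeal G ∧ ∀ i, (G ∩ D i).Nonempty := by
  -- Since `κ` may be finite, countable families are met by the Rasiowa–Sikorski construction
  -- instead.
  rcases le_or_gt #ι ℵ₀ with hc | hc
  · have : Countable ι := mk_le_aleph0_iff.1 hc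
    have := Encodable.ofCountable ι
    let E : ι → Order.Cofinal Q := fun i => ⟨D i, hD i⟩
    refine ⟨Order.idealOfCofinals p E, (Order.idealOfCofinals p E).isIdeal, fun i => ?_⟩
    obtain ⟨x, hx, hx'⟩ := Order.cofinal_meets_idealOfCofinals p E i
    exact ⟨x, hx', hx⟩
  · have hκ : #ι ≤ #κ.out := by
      rw [mk_out]
      rcases le_max_iff.1 hι with h | h
      · exact h
      · exact absurd h hc.not_ge
    obtain ⟨e⟩ := hκ
    have : Nonempty ι := mk_ne_zero_iff.1 (aleph0_pos.trans hc).ne'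
    choose A hAD hA using fun i => exists_isMaximalAntichain_subset (hD i)
    -- The axiom wants exactly `κ` antichains, so the family is padded with repetitions.
    obtain ⟨G, hG, -, hGA⟩ := h κ.out (mk_out κ) (fun j => A (Function.invFun e j)) (fun _ => hA _) p
    refine ⟨G, hG, fun i => ?_⟩
    obtain ⟨x, hxG, hx⟩ := hGA (e i)
    rw [Function.leftInverse_invFun e.injective] at hx
    exact ⟨x, hxG, hAD i hx⟩

namespace SeqName

variable {τ : SeqName P X} {p q : P} {n : ℕ} {x y : X}

theorem ForcesVal.mono (h : τ.ForcesVal p n x) (hpq : p ≤ q) : τ.ForcesVal q n x :=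
  fun r hr => h r (hpq.trans hr)

theorem forcesVal_of_mem (h : p ∈ τ.dec n x) (hpq : p ≤ q) : τ.ForcesVal q n x :=
  fun r hr => ⟨p, h, r, le_rfl, hpq.trans hr⟩

theorem ForcesVal.unique (h : τ.ForcesVal p n x) (h' : τ.ForcesVal p n y) : x = y := by
  obtain ⟨s, hs, r, hpr, hsr⟩ := h p le_rfl
  obtain ⟨t, ht, u, hru, htu⟩ := h' r hpr
  exact τ.functional n x y s t hs ht ⟨u, hsr.trans hru, htu⟩

theorem exists_forcesVal (τ : SeqName P X) (n : ℕ) (p : P) :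
    ∃ x, ∃ q, p ≤ q ∧ τ.ForcesVal q n x := by
  obtain ⟨x, s, hs, r, hpr, hsr⟩ := τ.total n p
  exact ⟨x, r, hpr, forcesVal_of_mem hs hsr⟩

theorem forcesVal_of_dense (h : ∀ q, p ≤ q → ∃ r, q ≤ r ∧ τ.ForcesVal r n x) :
    τ.ForcesVal p n x := by
  intro q hq
  obtain ⟨r, hqr, hr⟩ := h q hq
  obtain ⟨s, hs, u, hru, hsu⟩ := hr r le_rfl
  exact ⟨s, hs, u, hqr.trans hru, hsu⟩

theorem ForcesNew.mono (h : τ.ForcesNew p) (hpq : p ≤ q) : τ.ForcesNew q :=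
  fun f r hr => h f r (hpq.trans hr)

/-- `p ⊩ τ ↾ l = f ↾ l`. -/
def ForcesRestr (τ : SeqName P X) (p : P) (l : ℕ) (f : ℕ → X) : Prop :=
  ∀ n < l, τ.ForcesVal p n (f n)

theorem ForcesRestr.mono {l : ℕ} {f : ℕ → X} (h : τ.ForcesRestr p l f) (hpq : p ≤ q) :
    τ.ForcesRestr q l f :=
  fun n hn => (h n hn).mono hpq

theorem ForcesRestr.unique {k l : ℕ} {f g : ℕ → X} (hf : τ.ForcesRestr p k f)
    (hg : τ.ForcesRestr p l g) {n : ℕ} (hk : n < k) (hl : n < l) : f n = g n :=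
  (hf n hk).unique (hg n hl)

/-- Above every condition there is a branch all of whose initial segments are possible initial
segments of `τ`. -/
theorem exists_branch (τ : SeqName P X) (p : P) :
    ∃ η : ℕ → X, ∀ l, ∃ q, p ≤ q ∧ τ.ForcesRestr q l η := by
  choose v e he hv using τ.exists_forcesVal
  -- An increasing chain in which `c (n + 1)` decides `τ(n)`.
  let c : ℕ → P := fun n => Nat.rec p e n
  have hc : Monotone c := monotone_nat_of_le_succ fun n => he n (c n)
  exact ⟨fun n => v n (c n), fun l => ⟨c l, hc (Nat.zero_le l),
    fun n hn => (hv n (c n)).mono (hc (Nat.succ_le_of_lt hn))⟩⟩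

/-- A new sequence can be forced to leave a finite set of ground model sequences. -/
theorem ForcesNew.exists_avoid (h : τ.ForcesNew p) (w : Finset (ℕ → X)) :
    ∃ q, p ≤ q ∧ ∃ k, ∀ η ∈ w, ∃ n < k, ∃ x ≠ η n, τ.ForcesVal q n x := by
  classical
  induction w using Finset.induction_on with
  | empty => exact ⟨p, le_rfl, 0, by simp⟩
  | insert η w _ ih =>
    obtain ⟨q, hpq, k, hk⟩ := ih
    have hη : ∃ n, ¬ τ.ForcesVal q n (η n) := not_forall.1 (h η q hpq)
    obtain ⟨n, hn⟩ := hη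
    have hr : ∃ r, q ≤ r ∧ ∃ x ≠ η n, τ.ForcesVal r n x := by
      by_contra! hcon
      refine hn (forcesVal_of_dense fun q' hq' => ?_)
      obtain ⟨x, r, hr, hx⟩ := τ.exists_forcesVal n q'
      obtain rfl : x = η n := by
        by_contra hne
        exact hcon r (hq'.trans hr) x hne hx
      exact ⟨r, hr, hx⟩
    obtain ⟨r, hqr, x, hx, hrx⟩ := hr
    refine ⟨r, hpq.trans hqr, max k (n + 1), fun ζ hζ => ?_⟩
    rcases Finset.mem_insert.1 hζ with rfl | hζ
    · exact ⟨n, by omega, x, hx, hrx⟩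
    · obtain ⟨m, hm, y, hy, hqy⟩ := hk ζ hζ
      exact ⟨m, by omega, y, hy, hqy.mono hqr⟩

/-- The name whose value at `n` is the least `l > n` with `τ ↾ l ∈ A`, or `0` if there is
none. -/
def nextHit (τ : SeqName P Bool) (A : Set (List Bool)) : SeqName P ℕ where
  dec n m := {s | (∃ f, τ.ForcesRestr s m f ∧ n < m ∧ restr f m ∈ A ∧
      ∀ l, n < l → l < m → restr f l ∉ A) ∨
    (m = 0 ∧ ∀ t, s ≤ t → ∀ l f, n < l → τ.ForcesRestr t l f → restr f l ∉ A)}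
  functional := by
    -- If `k < l`, then `f` and `g` agree below `k`, so the hit of `f` at `k` is also one of `g`.
    have key : ∀ {u : P} {n k l : ℕ} {f g : ℕ → Bool}, τ.ForcesRestr u k f → τ.ForcesRestr u l g →
        n < k → restr f k ∈ A → (∀ j, n < j → j < l → restr g j ∉ A) → l ≤ k := by
      intro u n k l f g hf hg hk hfA hgA
      by_contra! hlt
      refine hgA k hk hlt ?_
      rwa [show restr g k = restr f k from List.map_congr_left fun j hj => by
        have := List.mem_range.1 hj
        exact hg.unique hf (this.trans hlt) this]
    rintro n x y p q (⟨f, hf, hx, hfA, hfm⟩ | ⟨rfl, hp⟩) (⟨g, hg, hy, hgA, hgm⟩ | ⟨rfl, hq⟩)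
      ⟨u, hpu, hqu⟩
    · exact (key (hg.mono hqu) (hf.mono hpu) hy hgA hfm).antisymm
        (key (hf.mono hpu) (hg.mono hqu) hx hfA hgm)
    · exact absurd hfA (hq u hqu x f hx (hf.mono hpu))
    · exact absurd hgA (hp u hpu y g hy (hg.mono hqu))
    · rfl
  total n p := by
    classical
    by_cases h : ∃ t, p ≤ t ∧ ∃ l f, n < l ∧ τ.ForcesRestr t l f ∧ restr f l ∈ A
    · obtain ⟨t, hpt, l, f, hl, hf, hfA⟩ := h
      have hex : ∃ l, n < l ∧ restr f l ∈ A := ⟨l, hl, hfA⟩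
      have hle : Nat.find hex ≤ l := Nat.find_min' hex ⟨hl, hfA⟩
      refine ⟨Nat.find hex, t, Or.inl ⟨f, fun j hj => hf j (hj.trans_le hle),
        (Nat.find_spec hex).1, (Nat.find_spec hex).2, fun j hj hjlt hjA => ?_⟩, t, hpt, le_rfl⟩
      exact Nat.find_min hex hjlt ⟨hj, hjA⟩
    · refine ⟨0, p, Or.inr ⟨rfl, fun t ht l f hl hf hfA => h ⟨t, ht, l, f, hl, hf, hfA⟩⟩,
        p, le_rfl, le_rfl⟩

/-- If above every condition some branch through the possible values of `τ` meets `A` finitely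
often, while `τ` meets `A` infinitely often, then the next hits of `τ` are unbounded. -/
theorem forcesUnbounded_nextHit {τ : SeqName P Bool} {A : Set (List Bool)} {p : P}
    (hbr : ∀ q, p ≤ q → ∃ η : ℕ → Bool, (∀ l, ∃ r, q ≤ r ∧ τ.ForcesRestr r l η) ∧
      ∃ L, ∀ l, L ≤ l → restr η l ∉ A)
    (hit : ∀ q, p ≤ q → ∀ n, ∃ r, q ≤ r ∧ ∃ l f, n < l ∧ τ.ForcesRestr r l f ∧ restr f l ∈ A) :
    (τ.nextHit A).ForcesUnbounded p := by
  intro g N q hpq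
  obtain ⟨η, hη, L, hL⟩ := hbr q hpq
  set n := max N L with hn
  obtain ⟨r, hqr, hr⟩ := hη (g n + 1)
  obtain ⟨m, s, hs, t, hrt, hst⟩ := (τ.nextHit A).total n r
  refine ⟨t, hqr.trans hrt, n, le_max_left _ _, m, ?_, forcesVal_of_mem hs hst⟩
  rcases hs with ⟨f, hf, hnm, hfA, -⟩ | ⟨-, hs⟩
  · by_contra! hle
    refine hL m (by omega) ?_
    rwa [show restr η m = restr f m from List.map_congr_left fun j hj => by
      have := List.mem_range.1 hj
      exact (hr.mono hrt).unique (hf.mono hst) (by omega) this]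
  -- The default value `0` is impossible, as a later hit can still be forced.
  · obtain ⟨u, htu, l, f, hl, hf, hfA⟩ := hit t (hpq.trans (hqr.trans hrt)) n
    exact absurd hfA (hs u (hst.trans htu) l f hl hf)

end SeqName

end Forcing

/-! ### Density arguments in `QCirc` -/

theorem length_restr (η : ℕ → Bool) (l : ℕ) : (restr η l).length = l := by simp [restr]

/-- The conditions of `Q_⊚` promising that `η` has only finitely many initial segments in the
generic set are cofinal. -/
theorem QCirc.isCofinal_mem_w (η : ℕ → Bool) : IsCofinal {c : QCirc | η ∈ c.w} := by
  classical
  exact fun c => ⟨⟨c.a, insert η c.w⟩, Finset.mem_insert_self _ _, subset_rfl,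
    Finset.subset_insert _ _, fun _ _ _ h => h⟩

/-- It is cofinal in `Q_⊚` that a given new real can be forced to have a long initial segment in the
generic set. -/
theorem QCirc.isCofinal_hit {P : Type u} [Preorder P] {τ : SeqName P Bool} {p : P}
    (hτ : τ.ForcesNew p) (n : ℕ) :
    IsCofinal {c : QCirc | ∃ r, p ≤ r ∧ ∃ l f, n < l ∧ τ.ForcesRestr r l f ∧ restr f l ∈ c.a} := by
  classical
  intro c
  obtain ⟨q, hpq, k, hk⟩ := hτ.exists_avoid c.w
  obtain ⟨f, hf⟩ := τ.exists_branch q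
  obtain ⟨r, hqr, hr⟩ := hf (max k (n + 1))
  -- The added node is long enough to have left every branch in `c.w`, so no promise is broken.
  refine ⟨⟨insert (restr f (max k (n + 1))) c.a, c.w⟩,
    ⟨r, hpq.trans hqr, _, f, by omega, hr, Finset.mem_insert_self _ _⟩,
    Finset.subset_insert _ _, subset_rfl, fun η hη l hl => ?_⟩
  rcases Finset.mem_insert.1 hl with heq | hl
  · exfalso
    obtain rfl : l = max k (n + 1) := by simpa [length_restr] using congrArg List.length heq
    obtain ⟨m, hm, x, hx, hqx⟩ := hk η hη
    have hm' : m < max k (n + 1) := by omega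
    have h1 : η m = f m := List.map_inj_left.1 heq m (List.mem_range.2 hm')
    exact hx (((hqx.mono hqr).unique (hr m hm')).trans h1.symm)
  · exact hl

/-- Under `MA_κ(Q_⊚)`, for a name `τ` of a real in a forcing notion of size at most `κ` there is a
name which is forced to be unbounded by every condition forcing `τ` to be new. -/
theorem SeqName.exists_forcesUnbounded {κ : Cardinal.{u}} (hMA : MartinAxiom κ QCirc)
    {P : Type u} [Preorder P] (hP : #P ≤ κ) (τ : SeqName P Bool) :
    ∃ σ : SeqName P ℕ, ∀ p, τ.ForcesNew p → σ.ForcesUnbounded p := by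
  choose η hη using τ.exists_branch
  -- The guard `τ.ForcesNew x.1` lets one filter, hence one `σ`, serve every `p`.
  let D : P ⊕ (P × ℕ) → Set QCirc := Sum.elim (fun p => {c | η p ∈ c.w}) fun x =>
    {c | τ.ForcesNew x.1 → ∃ r, x.1 ≤ r ∧ ∃ l f, x.2 < l ∧ τ.ForcesRestr r l f ∧ restr f l ∈ c.a}
  have hD : ∀ i, IsCofinal (D i) := by
    rintro (p | ⟨p, n⟩)
    · exact QCirc.isCofinal_mem_w (η p)
    · intro c
      by_cases hp : τ.ForcesNew p
      · obtain ⟨d, hd, hcd⟩ := QCirc.isCofinal_hit hp n c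
        exact ⟨d, fun _ => hd, hcd⟩
      · exact ⟨c, fun h => absurd h hp, le_rfl⟩
  have hcard : #(P ⊕ (P × ℕ)) ≤ max κ ℵ₀ := by
    have hP' : #P ≤ max κ ℵ₀ := hP.trans (le_max_left _ _)
    rw [mk_sum, mk_prod, lift_id, lift_id, lift_uzero, mk_nat, lift_aleph0]
    refine add_le_of_le (le_max_right _ _) hP' ?_
    exact mul_le_of_le (le_max_right _ _) hP' (le_max_right _ _)
  obtain ⟨G, hG, hGD⟩ := hMA.exists_isIdeal ⟨∅, ∅⟩ hcard D hD
  refine ⟨τ.nextHit {v | ∃ c ∈ G, v ∈ c.a}, fun p hp =>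
    forcesUnbounded_nextHit (fun q _ => ⟨η q, hη q, ?_⟩) fun q hq n => ?_⟩
  · obtain ⟨c, hcG, hc⟩ := hGD (Sum.inl q)
    -- Once `η q` is in `c.w`, its initial segments occurring anywhere in the filter already lie in
    -- the finite set `c.a`.
    refine ⟨c.a.sup List.length + 1, ?_⟩
    rintro l hl ⟨d, hdG, hd⟩
    obtain ⟨e, -, hce, hde⟩ := hG.Directed c hcG d hdG
    have := Finset.le_sup (f := List.length) (hce.2.2 _ hc l (hde.1 hd))
    rw [length_restr] at this
    omega
  · obtain ⟨c, hcG, hc⟩ := hGD (Sum.inr (q, n))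
    obtain ⟨r, hqr, l, f, hl, hf, hfc⟩ := hc (hp.mono hq)
    exact ⟨r, hqr, l, f, hl, hf, c, hcG, hfc⟩

/-! ### Mixing names along a maximal antichain -/

section Mixing

variable {P : Type u} [Preorder P]

/-- If every condition forces that there is a new real, then one name is forced by every condition
to be a new real. -/
theorem exists_forall_forcesNew (h : ∀ p : P, ForcesNewReal p) :
    ∃ τ : SeqName P Bool, ∀ p, τ.ForcesNew p := by
  have hD : IsCofinal {r : P | ∃ τ : SeqName P Bool, τ.ForcesNew r} := fun p => by
    obtain ⟨r, hpr, hr⟩ := h p p le_rfl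
    exact ⟨r, hr, hpr⟩
  obtain ⟨A, hAD, hA, hmax⟩ := exists_isMaximalAntichain_subset hD
  have : Nonempty (SeqName P Bool) :=
    ⟨fun _ x => {_p | x = true}, fun _ _ _ _ _ h k _ => h.trans k.symm,
      fun _ p => ⟨true, p, rfl, p, le_rfl, le_rfl⟩⟩
  choose! σ hσ using fun r (hr : r ∈ A) => hAD hr
  let τ : SeqName P Bool :=
    { dec := fun n x => {s | ∃ r ∈ A, r ≤ s ∧ (σ r).ForcesVal s n x}
      functional := by
        rintro n x y p q ⟨r, hr, hrp, hx⟩ ⟨r', hr', hrq, hy⟩ ⟨u, hpu, hqu⟩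
        obtain rfl : r = r' := by
          by_contra hne
          exact hA r hr r' hr' hne ⟨u, hrp.trans hpu, hrq.trans hqu⟩
        exact (hx.mono hpu).unique (hy.mono hqu)
      total := by
        intro n p
        obtain ⟨r, hr, u, hpu, hru⟩ := hmax p
        obtain ⟨x, v, huv, hv⟩ := (σ r).exists_forcesVal n u
        exact ⟨x, v, ⟨r, hr, hru.trans huv, hv⟩, v, hpu.trans huv, le_rfl⟩ }
  refine ⟨τ, fun p f q _ hqf => ?_⟩
  obtain ⟨r, hr, u, hqu, hru⟩ := hmax q
  refine hσ r hr f u hru fun n => SeqName.forcesVal_of_dense fun v huv => ?_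
  obtain ⟨s, ⟨r', hr', hrs, hs⟩, w, hvw, hsw⟩ := hqf n v (hqu.trans huv)
  obtain rfl : r = r' := by
    by_contra hne
    exact hA r hr r' hr' hne ⟨w, hru.trans (huv.trans hvw), hrs.trans hsw⟩
  exact ⟨w, hvw, hs.mono hsw⟩

end Mixing

/-! ### Regular open sets and distributivity -/

section RegularOpen

open OrderDual

variable {P : Type u} [Preorder P]

theorem mem_compl_iff_forall_le (a : LowerSet Pᵒᵈ) (p : P) :
    toDual p ∈ aᶜ ↔ ∀ q, p ≤ q → toDual q ∉ a := by
  rw [← LowerSet.Iic_le, le_compl_iff_disjoint_right, disjoint_iff_inf_le]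
  constructor
  · intro h q hpq hq
    exact h (show toDual q ∈ LowerSet.Iic (toDual p) ⊓ a from ⟨hpq, hq⟩)
  · rintro h q ⟨hpq, hq⟩
    exact h (ofDual q) hpq hq

/-- Membership of a condition in a regular open set. -/
def RO.Mem (p : P) (a : RO P) : Prop := toDual p ∈ (a : LowerSet Pᵒᵈ)

theorem RO.Mem.mono {p q : P} {a : RO P} (h : RO.Mem p a) (hpq : p ≤ q) : RO.Mem q a :=
  (a : LowerSet Pᵒᵈ).lower (show toDual q ≤ toDual p from hpq) h

theorem RO.le_iff {a b : RO P} : a ≤ b ↔ ∀ p, RO.Mem p a → RO.Mem p b :=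
  ⟨fun h _ hp => Heyting.Regular.coe_le_coe.2 h hp,
    fun h => Heyting.Regular.coe_le_coe.1 fun p hp => h (ofDual p) hp⟩

theorem RO.mem_compl {p : P} {a : RO P} : RO.Mem p aᶜ ↔ ∀ q, p ≤ q → ¬ RO.Mem q a := by
  rw [RO.Mem, Heyting.Regular.coe_compl, mem_compl_iff_forall_le]
  rfl

theorem RO.mem_of_dense {p : P} {a : RO P} (h : ∀ q, p ≤ q → ∃ r, q ≤ r ∧ RO.Mem r a) :
    RO.Mem p a := by
  rw [← compl_compl a, RO.mem_compl]
  intro q hq hqa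
  obtain ⟨r, hqr, hr⟩ := h q hq
  exact RO.mem_compl.1 hqa r hqr hr

/-- The regular open set of the conditions without an extension in `S`. -/
def RO.avoid (S : Set P) : RO P :=
  ⟨(⨆ p ∈ S, LowerSet.Iic (toDual p))ᶜ, Heyting.isRegular_compl _⟩

theorem RO.mem_avoid {p : P} {S : Set P} :
    RO.Mem p (RO.avoid S) ↔ ∀ q ∈ S, ¬ Compatible p q := by
  refine (mem_compl_iff_forall_le _ p).trans ?_
  simp only [LowerSet.mem_iSup_iff, LowerSet.mem_Iic_iff, not_exists, Compatible, toDual_le_toDual]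
  exact ⟨fun h q hq r hr => h r hr.1 q hq hr.2, fun h r hr q hq hqr => h q hq r ⟨hr, hqr⟩⟩

/-- Otherwise the regular open set of conditions incompatible with `p` would bound all `a m`, hence
contain `p`. -/
theorem RO.exists_mem_of_isLUB {a : ℕ → RO P} {s : RO P} (h : IsLUB (Set.range a) s) {p : P}
    (hp : RO.Mem p s) : ∃ r, p ≤ r ∧ ∃ m, RO.Mem r (a m) := by
  by_contra! hcon
  have hub : s ≤ RO.avoid {p} := h.2 <| by
    rintro _ ⟨m, rfl⟩
    refine RO.le_iff.2 fun q hq => RO.mem_avoid.2 ?_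
    rintro _ rfl ⟨r, hqr, hpr⟩
    exact hcon r hpr m (hq.mono hqr)
  exact RO.mem_avoid.1 (RO.le_iff.1 hub p hp) p rfl ⟨p, le_rfl, le_rfl⟩

theorem RO.exists_isGLB (a : ℕ → RO P) :
    ∃ b, IsGLB (Set.range a) b ∧ ∀ p, (∀ n, RO.Mem p (a n)) → RO.Mem p b := by
  have hmem : ∀ p, RO.Mem p (RO.avoid {q | ∃ n, RO.Mem q (a n)ᶜ}) ↔ ∀ n, RO.Mem p (a n) := by
    intro p
    rw [RO.mem_avoid]
    constructor
    · intro h n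
      refine RO.mem_of_dense fun q hq => ?_
      by_contra! hcon
      exact h q ⟨n, RO.mem_compl.2 hcon⟩ ⟨q, hq, le_rfl⟩
    · rintro h q ⟨n, hn⟩ ⟨r, hpr, hqr⟩
      exact RO.mem_compl.1 hn r hqr ((h n).mono hpr)
  refine ⟨_, ⟨?_, fun c hc => RO.le_iff.2 fun p hp => (hmem p).2 fun n =>
    RO.le_iff.1 (hc ⟨n, rfl⟩) p hp⟩, fun p => (hmem p).2⟩
  rintro _ ⟨n, rfl⟩
  exact RO.le_iff.2 fun p hp => (hmem p).1 hp n

/-- The name for the set of those `k` for which `a k` meets the generic filter. -/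
def RO.setName (a : ℕ → RO P) : SeqName P Bool where
  dec n x := {s | RO.Mem s (if x = true then a n else (a n)ᶜ)}
  functional := by
    rintro n (_ | _) (_ | _) p q hp hq ⟨r, hpr, hqr⟩
    · rfl
    · exact absurd (RO.Mem.mono hq hqr) (RO.mem_compl.1 hp r hpr)
    · exact absurd (RO.Mem.mono hp hpr) (RO.mem_compl.1 hq r hqr)
    · rfl
  total n p := by
    by_cases h : ∃ r, p ≤ r ∧ RO.Mem r (a n)
    · obtain ⟨r, hpr, hr⟩ := h
      exact ⟨true, r, hr, r, hpr, le_rfl⟩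
    · push Not at h
      exact ⟨false, p, RO.mem_compl.2 h, p, le_rfl, le_rfl⟩

theorem RO.setName_forcesVal_true {a : ℕ → RO P} {p : P} {n : ℕ} :
    (RO.setName a).ForcesVal p n true ↔ RO.Mem p (a n) := by
  refine ⟨fun h => RO.mem_of_dense fun q hq => ?_, fun h => SeqName.forcesVal_of_mem h le_rfl⟩
  obtain ⟨s, hs, r, hqr, hsr⟩ := h q hq
  exact ⟨r, hqr, RO.Mem.mono hs hsr⟩

/-- If `RO(P)` is not `(ω, ω)`-distributive then some condition forces a new real. -/
theorem exists_forcesNew_of_not_distributive (h : ¬ OmegaOmegaDistributive (RO P)) :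
    ∃ (τ : SeqName P Bool) (p : P), τ.ForcesNew p := by
  by_contra! hcon
  refine h fun a s t hs ht => ⟨?_, fun c hc => RO.le_iff.2 fun p hp => RO.mem_of_dense
    fun q hq => ?_⟩
  · rintro b ⟨f, hb⟩
    refine ht.2 ?_
    rintro _ ⟨n, rfl⟩
    exact (hb.1 ⟨n, rfl⟩).trans ((hs n).1 ⟨f n, rfl⟩)
  have hnew := hcon (RO.setName fun k => a k.unpair.1 k.unpair.2) q
  simp only [SeqName.ForcesNew, not_forall, not_not] at hnew
  obtain ⟨f, r, hqr, hrf⟩ := hnew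
  have hex : ∀ n, ∃ m, RO.Mem r (a n m) := by
    intro n
    have hrs : RO.Mem r (s n) := RO.le_iff.1 (ht.1 ⟨n, rfl⟩) r (hp.mono (hq.trans hqr))
    obtain ⟨u, hru, m, hm⟩ := RO.exists_mem_of_isLUB (hs n) hrs
    have hval : (RO.setName fun k => a k.unpair.1 k.unpair.2).ForcesVal u (Nat.pair n m) true :=
      RO.setName_forcesVal_true.2 (by simpa using hm)
    have hr := hrf (Nat.pair n m)
    -- Since `r` already decides the coded set, what `u` forces about `a n m` is forced by `r`
    -- itself.
    rw [(hr.mono hru).unique hval, RO.setName_forcesVal_true] at hr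
    exact ⟨m, by simpa using hr⟩
  choose g hg using hex
  obtain ⟨b, hb, hbmem⟩ := RO.exists_isGLB fun n => a n (g n)
  exact ⟨r, hqr, RO.le_iff.1 (hc ⟨g, hb⟩) r (hbmem r hg)⟩

end RegularOpen

end ForcingUnbounded

theorem mainTheorem5 (κ : Cardinal.{u})
    (hMA : ForcingUnbounded.MartinAxiom κ ForcingUnbounded.QCirc)
    (P : Type u) [Preorder P] (hP : Cardinal.mk P ≤ κ) :
    ((∀ p : P, ForcingUnbounded.ForcesNewReal p) →
      ∃ τ : ForcingUnbounded.SeqName P ℕ, ∀ p : P, τ.ForcesUnbounded p) ∧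
    (¬ ForcingUnbounded.OmegaOmegaDistributive (ForcingUnbounded.RO P) →
      ∃ p : P, ∃ τ : ForcingUnbounded.SeqName P ℕ, τ.ForcesUnbounded p) := by
  open ForcingUnbounded in
  refine ⟨fun h => ?_, fun h => ?_⟩
  · obtain ⟨τ, hτ⟩ := exists_forall_forcesNew h
    obtain ⟨σ, hσ⟩ := τ.exists_forcesUnbounded hMA hP
    exact ⟨σ, fun p => hσ p (hτ p)⟩
  · obtain ⟨τ, p, hp⟩ := exists_forcesNew_of_not_distributive h
    obtain ⟨σ, hσ⟩ := τ.exists_forcesUnbounded hMA hP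
    exact ⟨p, σ, hσ p hp⟩
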